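/- All ideals, subalgebras and maps are those of C*-algebras. For positive elements $a,b$ of a C*-algebra $A$ write $a\precsim b$ (Cuntz subequivalence) if there is a sequence $(v_k)$ in $A$ with $\|v_k b v_k^*-a\|\to 0$. For a self-adjoint $a$ and $\varepsilon>0$, $(a-\varepsilon)_+$ denotes $f(a)$ with $f(t)=\max(0,t-\varepsilon)$. For $x\in A$ and $B\subseteq A$, $x\in_\varepsilon B$ means that $\|x-y\|<\varepsilon$ for some $y\in B$. A completely positive map $\varphi$ has order zero if $ef=0$ implies $\varphi(e)\varphi(f)=0$. Let $n\ge 0$ be an integer. A unital C*-algebra $A$ is said to have the new type of tracial nuclear dimension at most $n$ if for every finite set $\mathcal F$ of positive elements of $A$, every $\varepsilon>0$ and every nonzero positive $a\in A$ there exist a finite-dimensional C*-algebra $F=F_0\oplus\cdots\oplus F_n$ and completely positive maps $\psi:A\to F$, $\varphi:F\to A$ such that 1. for every $x\in\mathcal F$ there is a positive $x'\in A$ with $\|x-x'-\varphi\psi(x)\|<\varepsilon$; 2. $(1_A-\varphi\psi(1_A)-\varepsilon)_+\precsim a$; 3. $\|\psi\|\le 1$; 4. for every $i=0,\dots,n$,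 the restriction $\varphi|_{F_i}$ is a contractive completely positive map of order zero. Let $\Omega$ be a class of unital C*-algebras, understood up to isomorphism. A simple unital C*-algebra $A$ belongs to $\mathrm{WTA}\Omega$ if for every $\varepsilon>0$, every finite set $S\subseteq A$ and every nonzero positive $a\in A$ there exist a projection $p\in A$, an element $g\in A$ with $0\le g\le 1$, and a C*-subalgebra $B$ of $A$ with unit $1_B=p$, $g\in B$ and $B\in\Omega$, such that 1. $(p-g)x\in_\varepsilon B$ and $x(p-g)\in_\varepsilon B$ for all $x\in S$; 2. $\|(p-g)x-x(p-g)\|<\varepsilon$ for all $x\in S$; 3. $1_A-(p-g)\precsim a$; 4. $\|(p-g)a(p-g)\|\ge\|a\|-\varepsilon$. **Theorem.** Let $n\ge 0$ and let $\Omega$ be a class of unital nuclear C*-algebras, each of which has the new type of tracial nuclear dimension at most $n$. Then every simple unital C*-algebra $A\in\mathrm{WTA}\Omega$ has the new type of tracial nuclear dimension at most $n$. -/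

import Mathlib

open Filter Topology
open scoped CStarAlgebra ComplexOrder

universe u

namespace TracialApprox

/-- A C*-algebra is simple if it is nonzero and has no closed two-sided ideals other than
`0` and itself. -/
def IsSimpleCStar (A : Type u) [CStarAlgebra A] : Prop :=
  Nontrivial A ∧ ∀ I : TwoSidedIdeal A, IsClosed (I : Set A) → I = ⊥ ∨ I = ⊤

/-- Cuntz subequivalence `a ≾ b` of positive elements of `A`: there are `v k` with
`‖v k * b * (v k)* - a‖ → 0`. For `a, b` in `A` it makes no difference whether the `v k` are
taken in `A` or in `M_∞(A)`, since `v k` may be replaced by its compression to the corner `A`. -/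
def CuntzSubeq {A : Type u} [CStarAlgebra A] (a b : A) : Prop :=
  ∃ v : ℕ → A, Tendsto (fun k => ‖v k * b * star (v k) - a‖) atTop (𝓝 0)

/-- `(a - ε)₊`, the continuous functional calculus of `t ↦ max 0 (t - ε)` at the self-adjoint
element `a`. -/
noncomputable def cutDown {A : Type u} [CStarAlgebra A] (a : A) (ε : ℝ) : A :=
  cfc (fun t : ℝ => max 0 (t - ε)) a

/-- A map between C*-algebras is contractive if `‖f x‖ ≤ ‖x‖` for all `x`. -/
def IsContractive {A B : Type*} [CStarAlgebra A] [CStarAlgebra B] (f : A → B) : Prop :=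
  ∀ x, ‖f x‖ ≤ ‖x‖

/-- A map between C*-algebras has order zero if it preserves orthogonality:
`e * f = 0` implies `φ e * φ f = 0`. -/
def IsOrderZero {A B : Type*} [CStarAlgebra A] [CStarAlgebra B] (φ : A → B) : Prop :=
  ∀ e f : A, e * f = 0 → φ e * φ f = 0

/-- Nuclearity (the completely positive approximation property): the identity of `A` is a
point-norm limit of maps `β ∘ α` with `α : A → M_k(ℂ)`, `β : M_k(ℂ) → A` completely positive
contractions. -/
def IsNuclear (A : Type u) [CStarAlgebra A] [PartialOrder A] [StarOrderedRing A] : Prop :=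
  ∀ (S : Finset A) (ε : ℝ), 0 < ε →
    ∃ (k : ℕ) (α : A →CP CStarMatrix (Fin k) (Fin k) ℂ)
      (β : CStarMatrix (Fin k) (Fin k) ℂ →CP A),
      IsContractive α ∧ IsContractive β ∧ ∀ x ∈ S, ‖β (α x) - x‖ < ε

/-- The new type of tracial nuclear dimension of the unital C*-algebra `A` is at most `n`.
The finite-dimensional C*-algebra `F₀ ⊕ ⋯ ⊕ F_n` is the product `∀ i, F i`, and the restriction
of `φ` to the `i`-th summand is `y ↦ φ (Pi.single i y)`. -/
def HasTracialNucDimLE (n : ℕ) (A : Type u) [CStarAlgebra A] [PartialOrder A]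
    [StarOrderedRing A] : Prop :=
  ∀ (S : Finset A), (∀ x ∈ S, 0 ≤ x) → ∀ ε : ℝ, 0 < ε → ∀ a : A, 0 ≤ a → a ≠ 0 →
    ∃ (F : Fin (n + 1) → Type u) (_ : ∀ i, CStarAlgebra (F i)) (_ : ∀ i, PartialOrder (F i))
      (_ : ∀ i, StarOrderedRing (F i)) (_ : ∀ i, FiniteDimensional ℂ (F i))
      (ψ : A →CP (∀ i, F i)) (φ : (∀ i, F i) →CP A),
      (∀ x ∈ S, ∃ x' : A, 0 ≤ x' ∧ ‖x - x' - φ (ψ x)‖ < ε) ∧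
      CuntzSubeq (cutDown (1 - φ (ψ 1)) ε) a ∧
      IsContractive ψ ∧
      ∀ i, IsContractive (fun y : F i => φ (Pi.single i y)) ∧
        IsOrderZero (fun y : F i => φ (Pi.single i y))

/-- `A` is weakly tracially approximated by the class `Ω` of unital C*-algebras. A C*-subalgebra
of `A` that belongs to `Ω`, with unit `p`, is given as the image of an injective *-homomorphism
`ι : B → A` with `Ω B` and `ι 1 = p`; so a class is understood up to isomorphism. -/
def InWTA (Ω : ∀ (B : Type u) [CStarAlgebra B], Prop) (A : Type u) [CStarAlgebra A]
    [PartialOrder A] [StarOrderedRing A] : Prop :=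
  ∀ ε : ℝ, 0 < ε → ∀ (S : Finset A) (a : A), 0 ≤ a → a ≠ 0 →
    ∃ (p g : A) (B : Type u) (_ : CStarAlgebra B) (ι : B →⋆ₙₐ[ℂ] A),
      IsStarProjection p ∧ 0 ≤ g ∧ g ≤ 1 ∧
      Ω B ∧ Function.Injective ι ∧ ι 1 = p ∧ (∃ g' : B, ι g' = g) ∧
      (∀ x ∈ S, (∃ y : B, ‖(p - g) * x - ι y‖ < ε) ∧ (∃ y : B, ‖x * (p - g) - ι y‖ < ε)) ∧
      (∀ x ∈ S, ‖(p - g) * x - x * (p - g)‖ < ε) ∧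
      CuntzSubeq (1 - (p - g)) a ∧
      ‖a‖ - ε ≤ ‖(p - g) * a * (p - g)‖

end TracialApprox

/-! If `A` is finite-dimensional, the identity factors through `A` itself. Otherwise simplicity
yields orthogonal nonzero positive `e`, `f` with `e² + f² ≾ a` and a nonzero `d ≥ 0` below both `e²`
and `f²`. Tracial approximation, applied with `d` in place of `a`, gives a subalgebra `B` and a
positive contraction `h = p - g` in it that almost commutes with the given elements and their square
roots, with `1 - h ≾ d` and `h d h` still large.

Nuclearity writes the identity of `B` approximately as `β ∘ α` through a matrix algebra, and
Arveson's theorem extends `α` to `α'` on `A`. If `ψ`, `φ` witness the dimension of `B`, the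
witnesses for `A` are `ψ ∘ β ∘ α' ∘ (h · h)` and `ι ∘ φ`.

For the first condition put `r = √x`. Then `x = r(1 - h²)r + r h² r`, where `r h² r ≈ h x h` lies
almost in `B`. There it splits into a positive element plus its image under `φψ`; that positive
element joins `r(1 - h²)r` in the remainder `x'`.

For the second, `1 - φψ(1)` for the new maps is `(1 - h²) + (h² - w)` with `w ≈ φψ(h²)`. The first
term is below `2(1 - h) ≾ e²`. The second is, up to a small scalar, at most the cut-down defect of
`B` (`sub_le_cutDown_add`), which is made Cuntz below `f²`. Orthogonality of `e²` and `f²` lets the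
two bounds be added. -/

namespace TracialApprox

/-! ### Cuntz comparison. -/

section Cuntz

variable {A : Type u} [CStarAlgebra A]

theorem cuntzSubeq_iff {a b : A} :
    CuntzSubeq a b ↔ ∀ ε : ℝ, 0 < ε → ∃ v : A, ‖v * b * star v - a‖ < ε := by
  constructor
  · rintro ⟨v, hv⟩ ε hε
    obtain ⟨k, hk⟩ := (hv.eventually (gt_mem_nhds hε)).exists
    exact ⟨v k, hk⟩
  · intro h
    choose v hv using fun k : ℕ => h (1 / (k + 1)) (by positivity)
    exact ⟨v, squeeze_zero (fun _ => norm_nonneg _) (fun k => (hv k).le)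
      tendsto_one_div_add_atTop_nhds_zero_nat⟩

theorem CuntzSubeq.conj (b v : A) : CuntzSubeq (v * b * star v) b :=
  cuntzSubeq_iff.2 fun ε hε => ⟨v, by simpa using hε⟩

theorem CuntzSubeq.of_approx {a b : A}
    (h : ∀ ε : ℝ, 0 < ε → ∃ a' : A, ‖a' - a‖ < ε ∧ CuntzSubeq a' b) : CuntzSubeq a b := by
  refine cuntzSubeq_iff.2 fun ε hε => ?_
  obtain ⟨a', ha', hb⟩ := h (ε / 2) (by positivity)
  obtain ⟨v, hv⟩ := cuntzSubeq_iff.1 hb (ε / 2) (by positivity)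
  refine ⟨v, ?_⟩
  have := norm_sub_le_norm_sub_add_norm_sub (v * b * star v) a' a
  linarith

theorem CuntzSubeq.trans {a b c : A} (hab : CuntzSubeq a b) (hbc : CuntzSubeq b c) :
    CuntzSubeq a c := by
  refine .of_approx fun ε hε => ?_
  obtain ⟨v, hv⟩ := cuntzSubeq_iff.1 hab ε hε
  refine ⟨v * b * star v, hv, .of_approx fun δ hδ => ?_⟩
  obtain ⟨w, hw⟩ := cuntzSubeq_iff.1 hbc (δ / (‖v‖ * ‖v‖ + 1)) (by positivity)
  refine ⟨(v * w) * c * star (v * w), ?_, .conj _ _⟩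
  have e : (v * w) * c * star (v * w) - v * b * star v
      = v * (w * c * star w - b) * star v := by
    simp only [star_mul]; noncomm_ring
  rw [e]
  calc _ ≤ ‖v‖ * ‖w * c * star w - b‖ * ‖star v‖ := norm_mul₃_le
    _ = (‖v‖ * ‖v‖) * ‖w * c * star w - b‖ := by rw [norm_star]; ring
    _ ≤ (‖v‖ * ‖v‖) * (δ / (‖v‖ * ‖v‖ + 1)) := by gcongr
    _ < δ := by
      rw [mul_div_assoc', div_lt_iff₀ (by positivity)]
      nlinarith [norm_nonneg v]

theorem CuntzSubeq.smul_self {r : ℝ} (hr : 0 ≤ r) (a : A) : CuntzSubeq (r • a) a := by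
  have := CuntzSubeq.conj a (Real.sqrt r • (1 : A))
  simpa [smul_smul, Real.mul_self_sqrt hr] using this

theorem cutDown_eq_posPart {a : A} (ha : IsSelfAdjoint a) (ε : ℝ) :
    cutDown a ε = (a - algebraMap ℝ A ε)⁺ := by
  have h : a - algebraMap ℝ A ε = cfc (fun t : ℝ => t - ε) a := by
    rw [cfc_sub _ _ a, cfc_id' ℝ a, cfc_const ε a]
  rw [h, CFC.posPart_def, cfcₙ_eq_cfc, ← cfc_comp' (fun t : ℝ => t⁺) (fun t : ℝ => t - ε) a]
  simp only [cutDown, _root_.posPart_def, sup_comm]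

variable [PartialOrder A] [StarOrderedRing A]

/-- With `v = a^(1/2) (b + δ)^(-1/2)` the error is exactly `-δ v v*`, and `a ≤ b + δ` forces `‖v‖ ≤
1`. -/
theorem CuntzSubeq.of_le {a b : A} (ha : 0 ≤ a) (hab : a ≤ b) : CuntzSubeq a b := by
  refine cuntzSubeq_iff.2 fun ε hε => ?_
  set δ : ℝ := ε / 2 with hδ
  have hδ0 : 0 < δ := by positivity
  have hb : 0 ≤ b := ha.trans hab
  set c : A := b + algebraMap ℝ A δ with hc
  have hcpos : IsStrictlyPositive c :=
    (IsStrictlyPositive.nonneg_add hb (by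
      rw [Algebra.algebraMap_eq_smul_one]; exact IsStrictlyPositive.smul hδ0 isStrictlyPositive_one))
  set w : A := c ^ (-(1 / 2) : ℝ) with hw
  have hw0 : 0 ≤ w := CFC.rpow_nonneg
  have hwsa : star w = w := (IsSelfAdjoint.of_nonneg hw0).star_eq
  have h1 : w * c * w = 1 := CFC.conjugate_rpow_neg_one_half c hcpos
  set s : A := CFC.sqrt a
  have hs : s * s = a := CFC.sqrt_mul_sqrt_self a ha
  have hssa : star s = s := (IsSelfAdjoint.of_nonneg (CFC.sqrt_nonneg a)).star_eq
  have h2 : w * b * w = 1 - δ • (w * w) := by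
    rw [eq_sub_iff_add_eq, ← h1, hc, mul_add, add_mul, Algebra.algebraMap_eq_smul_one]
    simp
  refine ⟨s * w, ?_⟩
  have e : s * w * b * star (s * w) - a = -(δ • ((s * w) * star (s * w))) := by
    have : s * w * b * star (s * w) = s * (w * b * w) * s := by
      simp [star_mul, hwsa, hssa, mul_assoc]
    rw [this, h2, star_mul, hwsa, hssa, ← hs]
    simp only [mul_sub, sub_mul, mul_one, mul_smul_comm, smul_mul_assoc, mul_assoc]
    abel
  rw [e, norm_neg, norm_smul, Real.norm_of_nonneg hδ0.le, CStarRing.norm_self_mul_star,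
    ← CStarRing.norm_star_mul_self]
  have h3 : star (s * w) * (s * w) = w * a * w := by
    rw [star_mul, hwsa, hssa, ← hs]; simp only [mul_assoc]
  have h4 : w * a * w ≤ 1 := by
    rw [← h1]
    refine conjugate_le_conjugate_of_nonneg (hab.trans ?_) hw0
    exact le_add_of_nonneg_right (algebraMap_nonneg A hδ0.le)
  have h5 : ‖star (s * w) * (s * w)‖ ≤ 1 := by
    rw [CStarAlgebra.norm_le_one_iff_of_nonneg _ (star_mul_self_nonneg _), h3]
    exact h4
  calc δ * _ ≤ δ * 1 := by gcongr
    _ < ε := by rw [hδ]; linarith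

/-- Conjugating by `(a + δ)⁻¹` turns `t³` into `t³ / (t + δ)²`, which is within `2δ` of `t` on `t ≥
0`. The absolute value in the proof keeps the function continuous on all of `ℝ`. -/
theorem CuntzSubeq.cube {a : A} (ha : 0 ≤ a) : CuntzSubeq a (a * a * a) := by
  refine cuntzSubeq_iff.2 fun ε hε => ?_
  set δ : ℝ := ε / 3 with hδ
  have hδ0 : 0 < δ := by positivity
  have hne : ∀ t : ℝ, |t| + δ ≠ 0 := fun t => by positivity
  have hcont : Continuous fun t : ℝ => (|t| + δ)⁻¹ :=
    Continuous.inv₀ (by fun_prop) hne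
  set v : A := cfc (fun t : ℝ => (|t| + δ)⁻¹) a
  have hv : star v = v := IsSelfAdjoint.star_eq (cfc_predicate _ a)
  refine ⟨v, ?_⟩
  have ha' : a = cfc (fun t : ℝ => t) a := (cfc_id' ℝ a).symm
  have e : v * (a * a * a) * star v - a
      = cfc (fun t : ℝ => (|t| + δ)⁻¹ * (t * t * t) * (|t| + δ)⁻¹ - t) a := by
    have c₁ : Continuous fun t : ℝ => t * t * t := by fun_prop
    have c₂ : Continuous fun t : ℝ => (|t| + δ)⁻¹ * (t * t * t) := hcont.mul c₁
    rw [cfc_sub (fun t : ℝ => (|t| + δ)⁻¹ * (t * t * t) * (|t| + δ)⁻¹) (fun t => t) a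
        (c₂.mul hcont).continuousOn,
      cfc_mul (fun t : ℝ => (|t| + δ)⁻¹ * (t * t * t)) _ a c₂.continuousOn hcont.continuousOn,
      cfc_mul (fun t : ℝ => (|t| + δ)⁻¹) _ a hcont.continuousOn c₁.continuousOn,
      cfc_mul (fun t : ℝ => t * t) (fun t => t) a, cfc_mul (fun t : ℝ => t) (fun t => t) a,
      ← ha', hv]
  rw [e]
  refine (norm_cfc_le (c := 2 * δ) (by positivity) fun t ht => ?_).trans_lt
    (by rw [hδ]; linarith)
  have ht0 : 0 ≤ t := spectrum_nonneg_of_nonneg ha ht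
  have hp : 0 < t + δ := by positivity
  rw [abs_of_nonneg ht0]
  have : (t + δ)⁻¹ * (t * t * t) * (t + δ)⁻¹ - t = -(t * (2 * t * δ + δ ^ 2) / (t + δ) ^ 2) := by
    field_simp; ring
  rw [this, norm_neg, Real.norm_of_nonneg (by positivity), div_le_iff₀ (by positivity)]
  nlinarith [mul_nonneg ht0 hδ0.le, mul_nonneg (mul_nonneg ht0 hδ0.le) hδ0.le, pow_pos hδ0 3]

/-- Since `y⁺ y⁻ = 0`, the cube of `y⁺` is `y⁺ y y⁺ ≤ y⁺ d y⁺ ≾ d`. Thus order bounds on `y` itself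
suffice, although `0 ≤ y` may fail. -/
theorem CuntzSubeq.posPart {y d : A} (hy : IsSelfAdjoint y) (hyd : y ≤ d) :
    CuntzSubeq y⁺ d := by
  have hp : 0 ≤ y⁺ := CFC.posPart_nonneg y
  have hsa : star y⁺ = y⁺ := (IsSelfAdjoint.of_nonneg hp).star_eq
  have h1 : y⁺ * y * y⁺ = y⁺ * y⁺ * y⁺ := by
    have : y⁺ * y = y⁺ * (y⁺ - y⁻) := by rw [CFC.posPart_sub_negPart y hy]
    rw [this, mul_sub, CFC.posPart_mul_negPart, sub_zero]
  have h2 : y⁺ * y⁺ * y⁺ ≤ y⁺ * d * y⁺ := h1 ▸ conjugate_le_conjugate_of_nonneg hyd hp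
  have h3 : CuntzSubeq (y⁺ * d * y⁺) d := by simpa [hsa] using CuntzSubeq.conj d y⁺
  exact (CuntzSubeq.cube hp).trans ((CuntzSubeq.of_le (conjugate_nonneg_of_nonneg hp hp) h2).trans h3)

theorem CuntzSubeq.add {d₁ d₂ a₁ a₂ : A} (h₁ : CuntzSubeq d₁ a₁) (h₂ : CuntzSubeq d₂ a₂)
    (ha₁ : 0 ≤ a₁) (ha₂ : 0 ≤ a₂) (h : a₁ * a₂ = 0) : CuntzSubeq (d₁ + d₂) (a₁ + a₂) := by
  have s₁ : star a₁ = a₁ := (IsSelfAdjoint.of_nonneg ha₁).star_eq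
  have s₂ : star a₂ = a₂ := (IsSelfAdjoint.of_nonneg ha₂).star_eq
  have h' : a₂ * a₁ = 0 := by simpa [s₁, s₂] using congrArg star h
  refine cuntzSubeq_iff.2 fun ε hε => ?_
  obtain ⟨v, hv⟩ := cuntzSubeq_iff.1 (h₁.trans (.cube ha₁)) (ε / 2) (by positivity)
  obtain ⟨w, hw⟩ := cuntzSubeq_iff.1 (h₂.trans (.cube ha₂)) (ε / 2) (by positivity)
  -- The factors `a₁`, `a₂` kill all cross terms; this costs two powers, which is why `v` and `w`
  -- were chosen for the cubes.
  refine ⟨v * a₁ + w * a₂, ?_⟩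
  have e : (v * a₁ + w * a₂) * (a₁ + a₂) * star (v * a₁ + w * a₂) - (d₁ + d₂)
      = (v * (a₁ * a₁ * a₁) * star v - d₁) + (w * (a₂ * a₂ * a₂) * star w - d₂) := by
    have : (v * a₁ + w * a₂) * (a₁ + a₂) = v * (a₁ * a₁) + w * (a₂ * a₂) := by
      simp [mul_add, add_mul, mul_assoc, h, h']
    rw [this, star_add, star_mul, star_mul, s₁, s₂]
    have c₁ : a₁ * (a₂ * star w) = 0 := by rw [← mul_assoc, h, zero_mul]
    have c₂ : a₂ * (a₁ * star v) = 0 := by rw [← mul_assoc, h', zero_mul]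
    simp only [mul_add, add_mul, mul_assoc, c₁, c₂, mul_zero, add_zero, zero_add]
    abel
  rw [e]
  exact (norm_add_le _ _).trans_lt (by linarith)

end Cuntz

/-! ### Consequences of simplicity. -/

section Simple

variable {A : Type u} [CStarAlgebra A]

/-- The linear span of the products `x * e * y`. -/
noncomputable def idealSpan (e : A) : Submodule ℂ A :=
  Submodule.span ℂ {z | ∃ x y : A, z = x * e * y}

theorem mul_mem_idealSpan {e z : A} (hz : z ∈ idealSpan e) (w w' : A) :
    w * z * w' ∈ idealSpan e := by
  induction hz using Submodule.span_induction with
  | mem z hz =>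
    obtain ⟨x, y, rfl⟩ := hz
    exact Submodule.subset_span ⟨w * x, y * w', by simp only [mul_assoc]⟩
  | zero => simp
  | add x y _ _ hx hy => rw [mul_add, add_mul]; exact add_mem hx hy
  | smul c x _ hx => rw [mul_smul_comm, smul_mul_assoc]; exact Submodule.smul_mem _ _ hx

/-- The closed ideal generated by `e` is everything, so the algebraic ideal has an element within
distance `1` of the unit. That element is invertible. -/
theorem IsSimpleCStar.one_mem_idealSpan (hA : IsSimpleCStar A) {e : A} (he : e ≠ 0) :
    (1 : A) ∈ idealSpan e := by
  set K := (idealSpan e).topologicalClosure with hK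
  have hmul : ∀ w w' z : A, z ∈ K → w * z * w' ∈ K := fun w w' z hz =>
    map_mem_closure (f := fun z => w * z * w') (by fun_prop) hz
      fun z hz => mul_mem_idealSpan hz w w'
  let J : TwoSidedIdeal A := .mk' (K : Set A) K.zero_mem K.add_mem K.neg_mem
    (fun {x y} h => by simpa using hmul x 1 y h) (fun {x y} h => by simpa using hmul 1 y x h)
  have hJ : ∀ x, x ∈ J ↔ x ∈ K := fun x => TwoSidedIdeal.mem_mk' _ _ _ _ _ _ x
  have hJK : (J : Set A) = K := Set.ext hJ
  have heJ : e ∈ J := (hJ e).2 <| Submodule.le_topologicalClosure _ <|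
    Submodule.subset_span ⟨1, 1, by simp⟩
  have h1 : (1 : A) ∈ K := by
    rcases hA.2 J (by rw [hJK]; exact (idealSpan e).isClosed_topologicalClosure) with h | h
    · rw [h] at heJ
      exact absurd ((TwoSidedIdeal.mem_bot _).1 heJ) he
    · exact (hJ 1).1 (h ▸ trivial)
  obtain ⟨z, hz, hz1⟩ := Metric.mem_closure_iff.1 h1 1 one_pos
  rw [dist_eq_norm] at hz1
  have := hA.1
  have hu : IsUnit z := by simpa using isUnit_one_sub_of_norm_lt_one hz1
  obtain ⟨u, rfl⟩ := hu
  simpa using mul_mem_idealSpan hz (↑u⁻¹) 1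

theorem IsSimpleCStar.exists_mul_mul_ne_zero (hA : IsSimpleCStar A) {a b : A} (ha : a ≠ 0)
    (hb : b ≠ 0) : ∃ w : A, a * w * b ≠ 0 := by
  by_contra! h
  have : idealSpan b ≤ LinearMap.ker (LinearMap.mulLeft ℂ a) := by
    refine Submodule.span_le.2 ?_
    rintro _ ⟨x, y, rfl⟩
    simp [← mul_assoc, h]
  exact ha (by simpa using this (hA.one_mem_idealSpan hb))

/-- Writing `1 = ∑ cᵢ xᵢ b yᵢ` on both sides of `z` leaves only middle factors `b (yᵢ z xⱼ) b`, all
multiples of `b²`. Hence the finitely many `xᵢ b² yⱼ` span. -/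
theorem IsSimpleCStar.finiteDimensional_of_forall_smul (hA : IsSimpleCStar A) {b : A}
    (hb : b ≠ 0) (h : ∀ y, ∃ r : ℂ, b * y * b = r • (b * b)) : FiniteDimensional ℂ A := by
  obtain ⟨m, c, g, hg⟩ := Submodule.mem_span_set'.1 (hA.one_mem_idealSpan hb)
  choose x y hxy using fun i => (g i).2
  choose r hr using h
  have h1 : ∑ i, c i • (x i * b * y i) = 1 := by simpa only [hxy] using hg
  set S : Set A := Set.range fun ij : Fin m × Fin m => x ij.1 * (b * b) * y ij.2
  refine ⟨⟨(Set.finite_range _ : S.Finite).toFinset, ?_⟩⟩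
  rw [Set.Finite.coe_toFinset, eq_top_iff]
  intro z _
  have hz : z = ∑ i, ∑ j, (c i * c j * r (y i * z * x j)) • (x i * (b * b) * y j) := by
    calc z = (∑ i, c i • (x i * b * y i)) * z * (∑ j, c j • (x j * b * y j)) := by simp [h1]
      _ = ∑ i, ∑ j, (c i * c j) • (x i * (b * (y i * z * x j) * b) * y j) := by
        simp only [Finset.sum_mul, Finset.mul_sum, smul_mul_assoc, mul_smul_comm, mul_assoc,
          Finset.smul_sum, smul_smul]
        rw [Finset.sum_comm]
        refine Finset.sum_congr rfl fun i _ => Finset.sum_congr rfl fun j _ => ?_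
        rw [mul_comm (c j)]
      _ = _ := by simp only [hr, mul_smul_comm, smul_mul_assoc, smul_smul]
  rw [hz]
  exact Submodule.sum_mem _ fun i _ => Submodule.sum_mem _ fun j _ =>
    Submodule.smul_mem _ _ (Submodule.subset_span ⟨(i, j), rfl⟩)

variable [PartialOrder A] [StarOrderedRing A]

theorem exists_conj_eq_smul {b : A} (hb : 0 ≤ b)
    (h : ∀ w : A, IsSelfAdjoint w → 0 ≤ b * w * b ∨ b * w * b ≤ 0) (y : A) :
    ∃ r : ℂ, b * y * b = r • (b * b) := by
  have key : ∀ y : A, IsSelfAdjoint y → ∃ r : ℝ, b * y * b = r • (b * b) := by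
    intro y hy
    have e : ∀ r : ℝ, b * (y - algebraMap ℝ A r) * b = b * y * b - r • (b * b) := fun r => by
      simp [Algebra.algebraMap_eq_smul_one, mul_sub, sub_mul]
    -- The two closed sets of `r` where `b y b - r b²` is positive, respectively negative, cover the
    -- connected line, and each is nonempty by `r = ∓‖y‖`. At a common point the difference
    -- vanishes.
    have := isPreconnected_closed_iff.1 (isPreconnected_univ (α := ℝ))
      {r | 0 ≤ b * y * b - r • (b * b)} {r | b * y * b - r • (b * b) ≤ 0}
      (isClosed_le (by fun_prop) (by fun_prop)) (isClosed_le (by fun_prop) (by fun_prop))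
      (fun r _ => by
        have := h (y - algebraMap ℝ A r) (hy.sub (.algebraMap A (.all r)))
        rwa [e] at this)
      ⟨-‖y‖, trivial, by
        rw [Set.mem_ofPred, ← e]
        refine conjugate_nonneg_of_nonneg ?_ hb
        rw [sub_nonneg, map_neg]
        exact hy.neg_algebraMap_norm_le_self⟩
      ⟨‖y‖, trivial, by
        rw [Set.mem_ofPred, ← e]
        have := conjugate_le_conjugate_of_nonneg (sub_nonpos.2 hy.le_algebraMap_norm_self) hb
        simpa using this⟩
    obtain ⟨r, -, h1, h2⟩ := this
    exact ⟨r, sub_eq_zero.1 (le_antisymm h2 h1)⟩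
  obtain ⟨r, hr⟩ := key _ (realPart y).2
  obtain ⟨s, hs⟩ := key _ (imaginaryPart y).2
  refine ⟨r + Complex.I * s, ?_⟩
  conv_lhs => rw [← realPart_add_I_smul_imaginaryPart y]
  rw [mul_add, add_mul, hr, mul_smul_comm, smul_mul_assoc, hs, add_smul, mul_smul]
  simp

/-- In a simple infinite-dimensional C*-algebra there are, below each nonzero `a ≥ 0`, two
orthogonal nonzero positive elements. -/
theorem IsSimpleCStar.exists_orthogonal (hA : IsSimpleCStar A) (hfin : ¬ FiniteDimensional ℂ A)
    {a : A} (ha : 0 ≤ a) (ha0 : a ≠ 0) :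
    ∃ e f : A, 0 ≤ e ∧ 0 ≤ f ∧ e ≠ 0 ∧ f ≠ 0 ∧ e * f = 0 ∧ CuntzSubeq (e * e + f * f) a := by
  set b : A := CFC.sqrt a
  have hb : 0 ≤ b := CFC.sqrt_nonneg a
  have hbb : b * b = a := CFC.sqrt_mul_sqrt_self a ha
  have hsb : star b = b := (IsSelfAdjoint.of_nonneg hb).star_eq
  have hb0 : b ≠ 0 := fun h => ha0 (by rw [← hbb, h, mul_zero])
  by_contra! hcon
  refine hfin (hA.finiteDimensional_of_forall_smul hb0 (exists_conj_eq_smul hb fun w hw => ?_))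
  -- If every such `z` has a definite sign, `A` is finite-dimensional. So some `z` has both parts
  -- nonzero, and `z⁺`, `z⁻` serve as `e`, `f` because `z² = (bw) a (bw)*`.
  set z := b * w * b with hz
  have hzsa : IsSelfAdjoint z := by
    rw [isSelfAdjoint_iff, hz, star_mul, star_mul, hsb, hw.star_eq, mul_assoc]
  rw [← CFC.negPart_eq_zero_iff z hzsa, ← CFC.posPart_eq_zero_iff z hzsa]
  by_contra! hne
  refine hcon z⁺ z⁻ (CFC.posPart_nonneg z) (CFC.negPart_nonneg z) hne.2 hne.1
    (CFC.posPart_mul_negPart z) ?_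
  have h1 : z⁺ * z⁺ + z⁻ * z⁻ = z * z := by
    conv_rhs => rw [← CFC.posPart_sub_negPart z hzsa]
    rw [sub_mul, mul_sub, mul_sub, CFC.posPart_mul_negPart, CFC.negPart_mul_posPart]
    abel
  have h2 : z * z = (b * w) * a * star (b * w) := by
    rw [star_mul, hsb, hw.star_eq, hz, ← hbb]; simp only [mul_assoc]
  rw [h1, h2]
  exact .conj _ _

/-- With `z = e w f ≠ 0` and `c = z* z`, take `d = c²`. Then `c` is a conjugate of `e²`, while `c² =
c c*` is a conjugate of `f²`. -/
theorem IsSimpleCStar.exists_common_subeq (hA : IsSimpleCStar A) {e f : A} (he : 0 ≤ e)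
    (hf : 0 ≤ f) (he0 : e ≠ 0) (hf0 : f ≠ 0) :
    ∃ d : A, 0 ≤ d ∧ d ≠ 0 ∧ CuntzSubeq d (e * e) ∧ CuntzSubeq d (f * f) := by
  obtain ⟨w, hw⟩ := hA.exists_mul_mul_ne_zero he0 hf0
  have hse : star e = e := (IsSelfAdjoint.of_nonneg he).star_eq
  have hsf : star f = f := (IsSelfAdjoint.of_nonneg hf).star_eq
  set z := e * w * f with hz
  set c := star z * z with hc
  have hc0 : 0 ≤ c := star_mul_self_nonneg z
  have hsc : star c = c := (IsSelfAdjoint.of_nonneg hc0).star_eq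
  have hcz : c ≠ 0 := fun h => hw ((CStarRing.star_mul_self_eq_zero_iff z).1 h)
  refine ⟨c * c, ?_, ?_, ?_, ?_⟩
  · simpa [hsc] using star_mul_self_nonneg c
  · intro h
    exact hcz ((CStarRing.star_mul_self_eq_zero_iff c).1 (by rwa [hsc]))
  · have h1 : c = (f * star w) * (e * e) * star (f * star w) := by
      rw [hc, hz]; simp only [star_mul, hse, hsf, star_star, mul_assoc]
    have h2 : CuntzSubeq (c * c) c := by
      have := CuntzSubeq.conj c (CFC.sqrt c)
      have e1 : CFC.sqrt c * CFC.sqrt c = c := CFC.sqrt_mul_sqrt_self c hc0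
      have e2 : CFC.sqrt c * c * star (CFC.sqrt c) = c * c := by
        rw [(IsSelfAdjoint.of_nonneg (CFC.sqrt_nonneg c)).star_eq]
        exact (fun s d (h : s * s = d) => by rw [← h]; simp only [mul_assoc] :
          ∀ s d : A, s * s = d → s * d * s = d * d) _ _ e1
      rwa [e2] at this
    refine h2.trans ?_
    conv_lhs => rw [h1]
    exact .conj _ _
  · have h1 : c * c = (star z * e * w) * (f * f) * star (star z * e * w) := by
      rw [hc]; simp only [star_mul, hse, star_star]; rw [hz]
      simp only [star_mul, hse, hsf, mul_assoc]
    rw [h1]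
    exact .conj _ _

end Simple

/-- A form of `CStarAlgebra.nonneg_iff_eq_star_mul_self` that applies to `CStarMatrix`. -/
theorem exists_eq_star_mul_self {A : Type*} [NonUnitalCStarAlgebra A] [PartialOrder A]
    [StarOrderedRing A] {a : A} (ha : 0 ≤ a) : ∃ x, a = star x * x :=
  CStarAlgebra.nonneg_iff_eq_star_mul_self.1 ha

theorem map_posPart_of_isSelfAdjoint {A B : Type*} [CStarAlgebra A] [CStarAlgebra B]
    (ι : B →⋆ₙₐ[ℂ] A) {b : B} (hb : IsSelfAdjoint b) :
    ι b⁺ = (ι b)⁺ := by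
  have hc : Continuous ι := map_continuous ι
  rw [CFC.posPart_def, CFC.posPart_def]
  exact NonUnitalStarAlgHomClass.map_cfcₙ (S := ℂ) ι _ b (hφa := hb.map ι)

/-! ### Extension of positive functionals. -/

section PositiveFunctional

variable {A B : Type*} [CStarAlgebra A] [PartialOrder A] [StarOrderedRing A]
  [CStarAlgebra B] [PartialOrder B] [StarOrderedRing B]

theorem map_nonneg_iff_of_injective {ι : B →⋆ₙₐ[ℂ] A} (hι : Function.Injective ι) {b : B}
    (hb : IsSelfAdjoint b) : 0 ≤ ι b ↔ 0 ≤ b := by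
  refine ⟨fun h => ?_, fun h => map_nonneg ι h⟩
  rw [← CFC.posPart_eq_self] at h ⊢
  rw [← map_posPart_of_isSelfAdjoint ι hb] at h
  exact hι h

theorem re_map_star_of_nonneg {s : B →ₗ[ℂ] ℂ} (hs : ∀ x, 0 ≤ x → 0 ≤ s x) (x : B) :
    (s (star x)).re = (s x).re := by
  have key : ∀ y : B, IsSelfAdjoint y → (s y).im = 0 := fun y hy => by
    have h1 := Complex.le_def.1 (hs _ (CFC.posPart_nonneg y))
    have h2 := Complex.le_def.1 (hs _ (CFC.negPart_nonneg y))
    rw [← CFC.posPart_sub_negPart y hy, map_sub, Complex.sub_im, ← h1.2, ← h2.2]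
    simp
  have := key (Complex.I • (x - star x)) (by
    rw [isSelfAdjoint_iff, star_smul, star_sub, star_star]
    simp [sub_eq_add_neg, add_comm])
  simp at this
  linarith

/-- A positive functional on a C*-subalgebra with unit `p` extends to a positive functional on the
whole algebra that lives on the corner of `p`. -/
theorem exists_positive_extension {ι : B →⋆ₙₐ[ℂ] A} (hι : Function.Injective ι) {s : B →ₗ[ℂ] ℂ}
    (hs : ∀ x, 0 ≤ x → 0 ≤ s x) :
    ∃ G : A →ₗ[ℂ] ℂ, (∀ x, 0 ≤ x → 0 ≤ G x) ∧ (∀ y, G (ι y) = s y) ∧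
      ∀ a, G (ι 1 * a * ι 1) = G a := by
  set p := ι 1 with hp
  have hpp : p * p = p := by rw [hp, ← map_mul, mul_one]
  have hsp : star p = p := by rw [hp, ← map_star, star_one]
  have hpB : ∀ y, p * ι y * p = ι y := fun y => by rw [hp, ← map_mul, ← map_mul]; simp
  have hsmul : ∀ (c : ℝ) (x : A), p * (c • x + star (c • x)) * p
      = c • (p * (x + star x) * p) := fun c x => by
    rw [star_smul, star_trivial, ← smul_add, mul_smul_comm, smul_mul_assoc]
  -- The cone tests only the compressed self-adjoint part, so a real functional nonnegative on it
  -- vanishes on skew-adjoint elements and outside the corner of `p`. Complexifying it then gives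
  -- positivity and the corner property together.
  let C : PointedCone ℝ A :=
    { carrier := {y | 0 ≤ p * (y + star y) * p}
      zero_mem' := by simp
      add_mem' := fun {x y} hx hy => by
        have e : p * (x + y + star (x + y)) * p
            = p * (x + star x) * p + p * (y + star y) * p := by
          simp only [star_add, mul_add, add_mul]; abel
        change 0 ≤ p * (x + y + star (x + y)) * p
        rw [e]; exact add_nonneg hx hy
      smul_mem' := fun c x hx => by
        change 0 ≤ p * ((c : ℝ) • x + star ((c : ℝ) • x)) * p
        rw [hsmul]; exact smul_nonneg c.2 hx }
  have hC : ∀ y, y ∈ C ↔ 0 ≤ p * (y + star y) * p := fun y => Iff.rfl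
  let ιr : B →ₗ[ℝ] A := (ι : B →ₗ[ℂ] A).restrictScalars ℝ
  let e : B ≃ₗ[ℝ] LinearMap.range ιr := LinearEquiv.ofInjective ιr hι
  let f : A →ₗ.[ℝ] ℝ := ⟨LinearMap.range ιr,
    (Complex.reLm ∘ₗ s.restrictScalars ℝ) ∘ₗ (e.symm : _ →ₗ[ℝ] B)⟩
  have hf : ∀ (y : B) (h : ι y ∈ f.domain), f ⟨ι y, h⟩ = (s y).re := by
    intro y h
    have : e.symm ⟨ι y, h⟩ = y := by rw [LinearEquiv.symm_apply_eq]; rfl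
    change (s (e.symm ⟨ι y, h⟩)).re = _
    rw [this]
  obtain ⟨g, hgf, hgC⟩ := riesz_extension C f
    (by
      rintro ⟨_, y, rfl⟩ hy
      refine le_of_le_of_eq ?_ (hf y ⟨y, rfl⟩).symm
      have h1 : 0 ≤ p * (ι y + star (ι y)) * p := hy
      rw [← map_star, ← map_add, hpB, map_nonneg_iff_of_injective hι (.add_star_self y)] at h1
      have h2 := (Complex.le_def.1 (hs _ h1)).1
      rw [map_add, Complex.add_re, re_map_star_of_nonneg hs] at h2
      simp at h2
      linarith)
    (by
      intro y
      have hsa : IsSelfAdjoint (y + star y) := .add_star_self y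
      set r : ℝ := ‖y + star y‖ with hr
      refine ⟨⟨ι (r • 1), r • 1, rfl⟩, ?_⟩
      change 0 ≤ p * ((ι (r • 1) + y) + star (ι (r • 1) + y)) * p
      have h0 : ι (r • 1) = r • p := (ιr.map_smul r 1)
      rw [h0, star_add, star_smul, hsp, star_trivial]
      have e1 : p * ((r • p + y) + (r • p + star y)) * p
          = p * (algebraMap ℝ A r + (y + star y)) * p + r • p := by
        simp only [Algebra.algebraMap_eq_smul_one, mul_add, add_mul, mul_smul_comm,
          smul_mul_assoc, hpp, mul_one]
        abel
      rw [e1]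
      have hp0 : 0 ≤ p := by
        have := star_mul_self_nonneg p
        rwa [hsp, hpp] at this
      refine add_nonneg (conjugate_nonneg_of_nonneg ?_ hp0) (smul_nonneg (norm_nonneg _) hp0)
      have := hsa.neg_algebraMap_norm_le_self
      rw [← sub_nonneg] at this
      simpa [add_comm] using this)
  have hg0 : ∀ y, p * (y + star y) * p = 0 → g y = 0 := fun y hy => by
    refine le_antisymm ?_ (hgC y ((hC y).2 hy.ge))
    have := hgC (-y) ((hC _).2 ?_)
    · rw [map_neg] at this; linarith
    · have e1 : p * (-y + star (-y)) * p = -(p * (y + star y) * p) := by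
        simp only [star_neg, mul_add, add_mul, mul_neg, neg_mul]; abel
      rw [e1, hy, neg_zero]
  have hgι : ∀ y, g (ι y) = (s y).re := fun y => by
    rw [← hf y ⟨y, rfl⟩]; exact hgf ⟨ι y, y, rfl⟩
  let G : A →ₗ[ℂ] ℂ := Module.Dual.extendRCLike g
  have hG : ∀ y, G y = (g y : ℂ) - Complex.I * (g (Complex.I • y) : ℂ) := fun y => rfl
  have hpz : ∀ z, p * z * p = 0 → g z = 0 := fun z hz => hg0 z <| by
    have hz' : p * star z * p = 0 := by
      have := congrArg star hz
      simpa [hsp, mul_assoc] using this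
    rw [mul_add, add_mul, hz, hz', add_zero]
  refine ⟨G, fun x hx => ?_, fun y => ?_, fun a => ?_⟩
  · have h1 : g (Complex.I • x) = 0 := hg0 _ <| by
      rw [star_smul, (IsSelfAdjoint.of_nonneg hx).star_eq]
      simp
    rw [hG, h1]
    have h2 : 0 ≤ g x := hgC x <| (hC x).2 <| by
      have := star_left_conjugate_nonneg (add_nonneg hx (star_nonneg_iff.2 hx)) p
      rwa [hsp] at this
    simpa using h2
  · rw [hG, ← map_smul, hgι, hgι]
    apply Complex.ext <;> simp
  · rw [← sub_eq_zero, ← map_sub]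
    set z := p * a * p - a with hz
    have hz0 : p * z * p = 0 := by
      have h1 : p * (p * a * p) * p = p * a * p := by
        rw [← mul_assoc, ← mul_assoc, hpp, mul_assoc, hpp]
      rw [hz, mul_sub, sub_mul, h1, sub_self]
    rw [hG, hpz z hz0, hpz (Complex.I • z) (by rw [mul_smul_comm, smul_mul_assoc, hz0, smul_zero])]
    simp

end PositiveFunctional

/-! ### Completely positive maps. -/

section CompletelyPositive

variable {A B C : Type*} [CStarAlgebra A] [PartialOrder A] [StarOrderedRing A]
  [CStarAlgebra B] [PartialOrder B] [StarOrderedRing B]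
  [CStarAlgebra C] [PartialOrder C] [StarOrderedRing C]

/-- The composition of completely positive maps. -/
noncomputable def cpComp (g : B →CP C) (f : A →CP B) : A →CP C :=
  { toLinearMap := g.toLinearMap ∘ₗ f.toLinearMap
    map_cstarMatrix_nonneg' := fun k M hM =>
      g.map_cstarMatrix_nonneg' k _ (f.map_cstarMatrix_nonneg' k M hM) }

@[simp] theorem cpComp_apply (g : B →CP C) (f : A →CP B) (x : A) : cpComp g f x = g (f x) := rfl

theorem cstarMatrix_nonneg_conj {m : ℕ} {M : CStarMatrix (Fin m) (Fin m) A} (hM : 0 ≤ M)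
    (v : Fin m → A) : 0 ≤ ∑ i, ∑ j, star (v i) * M i j * v j := by
  obtain ⟨X, rfl⟩ := exists_eq_star_mul_self hM
  have : ∑ i, ∑ j, star (v i) * (star X * X) i j * v j
      = ∑ t, star (∑ i, X t i * v i) * (∑ j, X t j * v j) := by
    simp only [CStarMatrix.mul_apply, CStarMatrix.star_apply, star_sum, star_mul,
      Finset.mul_sum, Finset.sum_mul, mul_assoc]
    rw [Finset.sum_comm]
    conv_rhs => rw [Finset.sum_comm]
    exact Finset.sum_congr rfl fun j _ => Finset.sum_comm
  rw [this]
  exact Finset.sum_nonneg fun t _ => star_mul_self_nonneg _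

theorem cstarMatrix_nonneg_of_star_mul {k : ℕ} (w : Fin k → A) :
    0 ≤ CStarMatrix.ofMatrix (.of fun i j => star (w i) * w j) := by
  rcases isEmpty_or_nonempty (Fin k) with h | ⟨⟨l⟩⟩
  · exact le_of_eq (CStarMatrix.ext fun i => (h.false i).elim)
  · let Z : CStarMatrix (Fin k) (Fin k) A :=
      CStarMatrix.ofMatrix (.of fun i j => if i = l then w j else 0)
    have : CStarMatrix.ofMatrix (.of fun i j => star (w i) * w j) = star Z * Z := by
      ext i j
      rw [CStarMatrix.mul_apply, Finset.sum_eq_single l]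
      · simp [Z, CStarMatrix.star_apply]
      · intro b _ hb; simp [Z, hb]
      · simp
    rw [this]
    exact star_mul_self_nonneg Z

/-- Conjugation by a self-adjoint element as a completely positive map. -/
noncomputable def cpConj (h : A) (hh : IsSelfAdjoint h) : A →CP A :=
  { toLinearMap := LinearMap.mulLeft ℂ h ∘ₗ LinearMap.mulRight ℂ h
    map_cstarMatrix_nonneg' := fun k M hM => by
      obtain ⟨X, rfl⟩ := exists_eq_star_mul_self hM
      let Z : CStarMatrix (Fin k) (Fin k) A :=
        CStarMatrix.ofMatrix (.of fun i j => X i j * h)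
      have : CStarMatrix.map (star X * X) (LinearMap.mulLeft ℂ h ∘ₗ LinearMap.mulRight ℂ h)
          = star Z * Z := by
        ext i j
        simp [Z, CStarMatrix.mul_apply, CStarMatrix.star_apply, hh.star_eq, mul_assoc]
      rw [this]
      exact star_mul_self_nonneg Z }

theorem cpConj_apply {h : A} (hh : IsSelfAdjoint h) (x : A) : cpConj h hh x = h * x * h :=
  (mul_assoc h x h).symm

/-- This is the Kadison–Schwarz argument: `φ` applied to the positive matrix with rows `(1, x)`,
`(x*, x*x)` and tested on `(-φ x, 1)` gives `φ(x)* φ(x) ≤ φ(x* x) ≤ ‖x‖²`. -/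
theorem IsContractive.of_norm_map_one_le {φ : A →CP B} (h1 : ‖φ 1‖ ≤ 1) : IsContractive φ := by
  intro x
  let v : Fin 2 → A := ![1, x]
  have hM := φ.map_cstarMatrix_nonneg' 2 _ (cstarMatrix_nonneg_of_star_mul v)
  have h2 := cstarMatrix_nonneg_conj hM ![-φ x, 1]
  have hφ0 : 0 ≤ φ 1 := map_nonneg φ zero_le_one
  have hφ1 : φ 1 ≤ 1 := (CStarAlgebra.norm_le_one_iff_of_nonneg _).1 h1
  have hmap : ∀ z, φ.toLinearMap z = φ z := fun _ => rfl
  have h3 : 0 ≤ star (φ x) * φ 1 * φ x - star (φ x) * φ x - φ (star x) * φ x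
      + φ (star x * x) := by
    convert h2 using 1
    simp [Fin.sum_univ_two, v, CStarMatrix.map_apply, hmap]
    abel
  have hstar : star (φ x) = φ (star x) := by
    have := CStarMatrix.star_apply_of_isSelfAdjoint (i := 0) (j := 1) (.of_nonneg hM)
    simpa [v, CStarMatrix.map_apply, hmap] using this
  have h4 : star (φ x) * φ 1 * φ x ≤ star (φ x) * φ x := by
    simpa using star_left_conjugate_le_conjugate hφ1 (φ x)
  have h5 : star (φ x) * φ x ≤ φ (star x * x) := by
    rw [← hstar] at h3
    have := add_nonneg h3 (sub_nonneg.2 h4)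
    rw [← sub_nonneg]
    convert this using 1; abel
  have h6 : φ (star x * x) ≤ algebraMap ℝ B (‖x‖ ^ 2) := by
    have : φ (star x * x) ≤ φ (algebraMap ℝ A (‖x‖ ^ 2)) :=
      OrderHomClass.mono φ CStarAlgebra.star_mul_le_algebraMap_norm_sq
    refine this.trans ?_
    have e : ∀ r : ℝ, φ (algebraMap ℝ A r) = r • φ 1 := fun r => by
      rw [Algebra.algebraMap_eq_smul_one, ← Complex.coe_smul, map_smul, Complex.coe_smul]
    rw [e, Algebra.algebraMap_eq_smul_one]
    exact smul_le_smul_of_nonneg_left hφ1 (by positivity)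
  have h7 : ‖star (φ x) * φ x‖ ≤ ‖x‖ ^ 2 := by
    rw [CStarAlgebra.norm_le_iff_le_algebraMap _ (by positivity) (star_mul_self_nonneg _)]
    exact h5.trans h6
  rw [CStarRing.norm_star_mul_self] at h7
  nlinarith [norm_nonneg (φ x), norm_nonneg x]

end CompletelyPositive

/-! ### Arveson extension into matrix algebras. -/

section Arveson

/-- The entry of a matrix as an additive map. -/
def entryHom {R : Type*} [AddCommMonoid R] {k : ℕ} (i j : Fin k) :
    CStarMatrix (Fin k) (Fin k) R →+ R :=
  { toFun := fun M => M i j, map_zero' := rfl, map_add' := fun _ _ => rfl }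

theorem sum_entry {R ι : Type*} [AddCommMonoid R] {k : ℕ} (t : Finset ι)
    (M : ι → CStarMatrix (Fin k) (Fin k) R) (i j : Fin k) :
    (∑ l ∈ t, M l) i j = ∑ l ∈ t, M l i j :=
  map_sum (entryHom i j) _ _

-- Flattening the double indices gives a positive semidefinite scalar matrix; a factorization `X* X`
-- of it folds back into blocks.
open scoped MatrixOrder in
theorem cstarMatrix_cstarMatrix_nonneg {m k : ℕ}
    (M : CStarMatrix (Fin m) (Fin m) (CStarMatrix (Fin k) (Fin k) ℂ))
    (h : ∀ v : Fin m → Fin k → ℂ,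
      0 ≤ ∑ r, ∑ i, ∑ s, ∑ j, star (v r i) * M r s i j * v s j) : 0 ≤ M := by
  let N : Matrix (Fin m × Fin k) (Fin m × Fin k) ℂ := .of fun p q => M p.1 q.1 p.2 q.2
  have hN : N.PosSemidef := by
    rw [← Matrix.isPositive_toEuclideanLin_iff, LinearMap.isPositive_iff_complex]
    intro x
    have h1 := h fun r i => x (r, i)
    have h2 : inner ℂ x (N.toEuclideanLin x)
        = ∑ r, ∑ i, ∑ s, ∑ j, star (x (r, i)) * M r s i j * x (s, j) := by
      rw [PiLp.inner_apply, Fintype.sum_prod_type]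
      refine Finset.sum_congr rfl fun r _ => Finset.sum_congr rfl fun i _ => ?_
      simp [Matrix.mulVec, dotProduct, Fintype.sum_prod_type, N, Finset.sum_mul]
      exact Finset.sum_congr rfl fun s _ => Finset.sum_congr rfl fun j _ => by ring
    rw [← h2, Complex.le_def] at h1
    rw [← inner_conj_symm]
    refine ⟨Complex.ext ?_ ?_, ?_⟩
    · rw [RCLike.conj_re]; rfl
    · rw [Complex.conj_im, ← h1.2]; simp
    · rw [RCLike.conj_re]; exact h1.1
  obtain ⟨X, hX⟩ := CStarAlgebra.nonneg_iff_eq_star_mul_self.1 (Matrix.nonneg_iff_posSemidef.2 hN)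
  let Y : CStarMatrix (Fin m) (Fin m) (CStarMatrix (Fin k) (Fin k) ℂ) :=
    CStarMatrix.ofMatrix (.of fun r s => CStarMatrix.ofMatrix (.of fun i j => X (r, i) (s, j)))
  have : M = star Y * Y := by
    ext r s i j
    have h1 : M r s i j = N (r, i) (s, j) := rfl
    rw [h1, hX, Matrix.mul_apply, Fintype.sum_prod_type, CStarMatrix.mul_apply, sum_entry]
    refine Finset.sum_congr rfl fun t _ => ?_
    rw [CStarMatrix.mul_apply]
    rfl
  rw [this]
  exact star_mul_self_nonneg Y

variable {A B : Type*} [CStarAlgebra A] [PartialOrder A] [StarOrderedRing A]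
  [CStarAlgebra B] [PartialOrder B] [StarOrderedRing B]

/-- The matrix over `A` with a single nonzero entry. -/
noncomputable def singleEntry {A : Type*} [CStarAlgebra A] {k : ℕ} (i j : Fin k) :
    A →ₗ[ℂ] CStarMatrix (Fin k) (Fin k) A :=
  CStarMatrix.ofMatrixₗ.toLinearMap ∘ₗ Matrix.singleLinearMap ℂ i j

theorem singleEntry_apply {A : Type*} [CStarAlgebra A] {k : ℕ} (i j : Fin k) (a : A)
    (r s : Fin k) : singleEntry i j a r s = if i = r ∧ j = s then a else 0 := rfl

theorem eq_sum_singleEntry {A : Type*} [CStarAlgebra A] {k : ℕ}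
    (M : CStarMatrix (Fin k) (Fin k) A) : M = ∑ i, ∑ j, singleEntry i j (M i j) := by
  ext r s
  simp only [sum_entry, singleEntry_apply]
  rw [Finset.sum_eq_single r, Finset.sum_eq_single s] <;> simp +contextual

/-- The completely positive map into `M_k(ℂ)` that corresponds to a positive functional on
`M_k(A)`. -/
noncomputable def cpOfFunctional {k : ℕ} (G : CStarMatrix (Fin k) (Fin k) A →ₗ[ℂ] ℂ)
    (hG : ∀ x, 0 ≤ x → 0 ≤ G x) : A →CP CStarMatrix (Fin k) (Fin k) ℂ :=
  { toFun := fun a => CStarMatrix.ofMatrix (.of fun i j => G (singleEntry i j a))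
    map_add' := fun a b => by ext; simp
    map_smul' := fun c a => by ext; simp
    map_cstarMatrix_nonneg' := fun m M hM => by
      obtain ⟨X, rfl⟩ := exists_eq_star_mul_self hM
      refine cstarMatrix_cstarMatrix_nonneg _ fun v => ?_
      -- The quadratic form in `v` becomes `G` of a sum of the positive matrices `(w(t, i)* w(t,
      -- j))` over `t`.
      let w : Fin m → Fin k → A := fun t i => ∑ s, v s i • X t s
      have h1 : 0 ≤ G (∑ t, CStarMatrix.ofMatrix (.of fun i j => star (w t i) * w t j)) :=
        hG _ (Finset.sum_nonneg fun t _ => cstarMatrix_nonneg_of_star_mul (w t))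
      have hw : ∀ i j, ∑ t, star (w t i) * w t j
          = ∑ r, ∑ s, (star (v r i) * v s j) • (star X * X) r s := fun i j => by
        simp only [w, star_sum, star_smul, Finset.sum_mul, Finset.mul_sum, smul_mul_assoc,
          mul_smul_comm, smul_smul, CStarMatrix.mul_apply, CStarMatrix.star_apply,
          Finset.smul_sum]
        rw [Finset.sum_comm]
        refine ((Finset.sum_congr rfl fun s _ => Finset.sum_comm).trans Finset.sum_comm).trans ?_
        simp only [mul_comm]
      refine h1.trans_eq ?_
      rw [eq_sum_singleEntry (∑ t, _)]
      simp only [sum_entry, CStarMatrix.ofMatrix_apply, Matrix.of_apply, hw, map_sum, map_smul,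
        smul_eq_mul]
      rw [Finset.sum_comm (s := Finset.univ (α := Fin m))]
      refine Finset.sum_congr rfl fun i _ => ?_
      rw [Finset.sum_comm]
      refine Finset.sum_congr rfl fun r _ => ?_
      rw [Finset.sum_comm]
      refine Finset.sum_congr rfl fun s _ => Finset.sum_congr rfl fun j _ => ?_
      rw [mul_right_comm]
      rfl }

theorem cpOfFunctional_apply {k : ℕ} (G : CStarMatrix (Fin k) (Fin k) A →ₗ[ℂ] ℂ)
    (hG : ∀ x, 0 ≤ x → 0 ≤ G x) (a : A) (i j : Fin k) :
    cpOfFunctional G hG a i j = G (singleEntry i j a) := rfl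

/-- **Arveson's extension theorem** for maps into matrix algebras. -/
theorem exists_cp_extension {ι : B →⋆ₙₐ[ℂ] A} (hι : Function.Injective ι) {k : ℕ}
    (α : B →CP CStarMatrix (Fin k) (Fin k) ℂ) (hα : IsContractive α) :
    ∃ β : A →CP CStarMatrix (Fin k) (Fin k) ℂ, IsContractive β ∧ ∀ y, β (ι y) = α y := by
  let ιk : CStarMatrix (Fin k) (Fin k) B →⋆ₙₐ[ℂ] CStarMatrix (Fin k) (Fin k) A :=
    CStarMatrix.mapₙₐ ι
  have hιk : Function.Injective ιk := fun x y h => by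
    ext i j
    exact hι (congrFun (congrFun h i) j)
  -- This positive functional on `M_k(B)` encodes `α`; its extension to `M_k(A)` is decoded by
  -- `cpOfFunctional`.
  let s : CStarMatrix (Fin k) (Fin k) B →ₗ[ℂ] ℂ :=
    { toFun := fun x => ∑ i, ∑ j, α (x i j) i j
      map_add' := fun x y => by simp [Finset.sum_add_distrib]
      map_smul' := fun c x => by simp [Finset.mul_sum] }
  have hs : ∀ x, 0 ≤ x → 0 ≤ s x := by
    intro x hx
    obtain ⟨X, hX⟩ := exists_eq_star_mul_self (α.map_cstarMatrix_nonneg' k x hx)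
    have h1 : ∀ i j, α (x i j) = (star X * X) i j := fun i j => by rw [← hX]; rfl
    have h2 : s x = ∑ t, ∑ l, star (∑ i, X t i l i) * ∑ j, X t j l j := by
      change ∑ i, ∑ j, α (x i j) i j = _
      simp only [h1, CStarMatrix.mul_apply, sum_entry, CStarMatrix.star_apply, star_sum, Finset.sum_mul,
        Finset.mul_sum]
      exact (Finset.sum_congr rfl fun i _ => Finset.sum_comm).trans (Finset.sum_comm.trans
        (Finset.sum_congr rfl fun t _ => (Finset.sum_congr rfl fun i _ => Finset.sum_comm).trans
          (Finset.sum_comm.trans (Finset.sum_congr rfl fun l _ => Finset.sum_comm))))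
    rw [h2]
    exact Finset.sum_nonneg fun t _ => Finset.sum_nonneg fun l _ => star_mul_self_nonneg _
  obtain ⟨G, hG, hGs, hG1⟩ := exists_positive_extension hιk hs
  have hext : ∀ y, cpOfFunctional G hG (ι y) = α y := by
    intro y
    ext i j
    have h1 : singleEntry i j (ι y) = ιk (singleEntry i j y) := by
      ext r t
      change _ = ι (singleEntry i j y r t)
      rw [singleEntry_apply, singleEntry_apply, apply_ite ι, map_zero]
    rw [cpOfFunctional_apply, h1, hGs]
    change ∑ r, ∑ t, α (singleEntry i j y r t) r t = _
    rw [Finset.sum_eq_single i, Finset.sum_eq_single j]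
    · simp [singleEntry_apply]
    · intro t _ ht; simp [singleEntry_apply, ht.symm]
    · simp
    · intro r _ hr; simp [singleEntry_apply, hr.symm]
    · simp
  refine ⟨cpOfFunctional G hG, .of_norm_map_one_le ?_, hext⟩
  -- Because `G` lives on the corner of `ι 1`, the extension takes the same value at `1` and `ι 1`;
  -- this keeps it contractive even when `ι` is not unital.
  have h1 : cpOfFunctional G hG 1 = cpOfFunctional G hG (ι 1) := by
    ext i j
    rw [cpOfFunctional_apply, cpOfFunctional_apply, ← hG1]
    congr 1
    have hone : ∀ r t, ιk 1 r t = if r = t then ι 1 else 0 := fun r t => by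
      change ι ((1 : CStarMatrix (Fin k) (Fin k) B) r t) = _
      rw [CStarMatrix.one_apply, apply_ite ι, map_zero]
    ext r t
    simp only [CStarMatrix.mul_apply, hone, singleEntry_apply]
    rw [Finset.sum_eq_single t, Finset.sum_eq_single r]
    · by_cases h : i = r ∧ j = t <;> simp [h, ← map_mul]
    · intro b _ hb; simp [hb.symm]
    · simp
    · intro b _ hb; simp [hb]
    · simp
  rw [h1, hext]
  refine (hα 1).trans ?_
  rcases subsingleton_or_nontrivial B with h | h
  · simp [Subsingleton.elim (1 : B) 0]
  · simp

end Arveson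

/-! ### The finite-dimensional case and approximation inside a subalgebra. -/

section Main

theorem isContractive_nonUnitalStarAlgHom {A B : Type*} [CStarAlgebra A] [CStarAlgebra B]
    (ι : B →⋆ₙₐ[ℂ] A) : IsContractive ι :=
  NonUnitalStarAlgHom.norm_apply_le ι

/-- A *-homomorphism as a completely positive map. -/
noncomputable def cpOfStarAlgHom {A B : Type*} [CStarAlgebra A] [PartialOrder A] [StarOrderedRing A]
    [CStarAlgebra B] [PartialOrder B] [StarOrderedRing B] (ι : B →⋆ₙₐ[ℂ] A) : B →CP A :=
  CompletelyPositiveMapClass.toCompletelyPositiveLinearMap ι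

theorem CuntzSubeq.map {A B : Type u} [CStarAlgebra A] [CStarAlgebra B] (ι : B →⋆ₙₐ[ℂ] A)
    {x y : B} (h : CuntzSubeq x y) : CuntzSubeq (ι x) (ι y) := by
  refine cuntzSubeq_iff.2 fun ε hε => ?_
  obtain ⟨v, hv⟩ := cuntzSubeq_iff.1 h ε hε
  refine ⟨ι v, lt_of_le_of_lt ?_ hv⟩
  rw [← map_star, ← map_mul, ← map_mul, ← map_sub]
  exact isContractive_nonUnitalStarAlgHom ι _

/-- Finite-dimensional algebras have tracial nuclear dimension zero. -/
theorem hasTracialNucDimLE_of_finiteDimensional (n : ℕ) (A : Type u) [CStarAlgebra A]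
    [PartialOrder A] [StarOrderedRing A] [FiniteDimensional ℂ A] : HasTracialNucDimLE n A := by
  intro S _ ε hε a _ _
  let ψ : A →⋆ₙₐ[ℂ] (Fin (n + 1) → A) :=
    { toFun := fun x _ => x
      map_smul' := fun _ _ => rfl
      map_zero' := rfl
      map_add' := fun _ _ => rfl
      map_mul' := fun _ _ => rfl
      map_star' := fun _ => rfl }
  let φ : (Fin (n + 1) → A) →⋆ₙₐ[ℂ] A :=
    { toFun := fun x => x 0
      map_smul' := fun _ _ => rfl
      map_zero' := rfl
      map_add' := fun _ _ => rfl
      map_mul' := fun _ _ => rfl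
      map_star' := fun _ => rfl }
  have hφψ : ∀ x, cpOfStarAlgHom φ (cpOfStarAlgHom ψ x) = x := fun _ => rfl
  refine ⟨fun _ => A, fun _ => inferInstance, fun _ => inferInstance, fun _ => inferInstance,
    fun _ => inferInstance, cpOfStarAlgHom ψ, cpOfStarAlgHom φ, fun x _ => ⟨0, le_rfl, ?_⟩, ?_,
    isContractive_nonUnitalStarAlgHom ψ, fun i => ⟨fun y => ?_, fun x y hxy => ?_⟩⟩
  · simpa [hφψ] using hε
  · have : cutDown (1 - cpOfStarAlgHom φ (cpOfStarAlgHom ψ 1)) ε = 0 := by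
      rw [hφψ, sub_self, cutDown, cfc_apply_zero]
      simp [hε.le]
    rw [this]
    exact cuntzSubeq_iff.2 fun δ hδ => ⟨0, by simpa using hδ⟩
  · exact (isContractive_nonUnitalStarAlgHom φ _).trans (Pi.norm_single y).le
  · change (Pi.single i x : Fin (n + 1) → A) 0 * (Pi.single i y : Fin (n + 1) → A) 0 = 0
    rcases eq_or_ne 0 i with rfl | h
    · simpa using hxy
    · simp [h]

variable {A B : Type u} [CStarAlgebra A] [PartialOrder A] [StarOrderedRing A]
  [CStarAlgebra B]

theorem le_smul_one_of_norm_le {u : A} (hu : IsSelfAdjoint u) {δ : ℝ} (h : ‖u‖ ≤ δ) :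
    u ≤ δ • (1 : A) := by
  rw [← Algebra.algebraMap_eq_smul_one]
  exact hu.le_algebraMap_norm_self.trans (algebraMap_mono A h)

/-- Elements of a hereditary corner that almost lie in a subalgebra are approximated there by
self-adjoint elements, both in norm and in the order. -/
theorem exists_corner_approx (ι : B →⋆ₙₐ[ℂ] A) {h' : B} (hh' : IsSelfAdjoint h') (hn : ‖h'‖ ≤ 1)
    {x : A} (hx : IsSelfAdjoint x) {y₀ : B} {δ : ℝ} (hy : ‖ι h' * x - ι y₀‖ < δ) :
    ∃ y : B, IsSelfAdjoint y ∧ ‖ι h' * x * ι h' - ι y‖ ≤ δ ∧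
      ι h' * x * ι h' - ι y ≤ δ • ι 1 ∧ ι y - ι h' * x * ι h' ≤ δ • ι 1 := by
  have hhs : star (ι h') = ι h' := (hh'.map ι).star_eq
  have hns : ‖ι h'‖ ≤ 1 := (isContractive_nonUnitalStarAlgHom ι h').trans hn
  set X : A := ι h' * x * ι h' with hX
  have hXs : star X = X := by rw [hX, star_mul, star_mul, hhs, hx.star_eq, mul_assoc]
  set z : B := y₀ * h' with hz
  have h1 : ‖X - ι z‖ ≤ δ := by
    have : X - ι z = (ι h' * x - ι y₀) * ι h' := by rw [hz, map_mul, sub_mul]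
    rw [this]
    exact (norm_mul_le _ _).trans ((mul_le_of_le_one_right (norm_nonneg _) hns).trans hy.le)
  have h2 : ‖X - ι (star z)‖ ≤ δ := by
    rw [← norm_star, star_sub, hXs, map_star, star_star]; exact h1
  set y : B := (1 / 2 : ℂ) • (z + star z) with hy'
  have hys : IsSelfAdjoint y := by
    rw [isSelfAdjoint_iff, hy', star_smul, star_add, star_star, add_comm (star z)]
    congr 1
    simp
  have h3 : ‖X - ι y‖ ≤ δ := by
    have : X - ι y = (1 / 2 : ℂ) • ((X - ι z) + (X - ι (star z))) := by
      rw [hy', map_smul, map_add]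
      module
    rw [this, norm_smul]
    have := norm_add_le (X - ι z) (X - ι (star z))
    have h12 : ‖(1 / 2 : ℂ)‖ = 1 / 2 := by simp
    rw [h12]
    linarith
  have hsp : star (ι (1 : B)) = ι 1 := by rw [← map_star, star_one]
  have hpp : ι (1 : B) * ι 1 = ι 1 := by rw [← map_mul, mul_one]
  have hph : ι 1 * ι h' = ι h' := by rw [← map_mul, one_mul]
  have hhp : ι h' * ι 1 = ι h' := by rw [← map_mul, mul_one]
  have hus : IsSelfAdjoint (X - ι y) := .sub hXs (hys.map ι)
  have hpup : ι 1 * (X - ι y) * ι 1 = X - ι y := by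
    rw [mul_sub, sub_mul, ← map_mul, ← map_mul, one_mul, mul_one, hX]
    simp only [← mul_assoc, hph]
    rw [mul_assoc, hhp]
  -- Compressing by `ι 1` replaces the bound `δ • 1` by `δ • ι 1`, which lies in the image of `ι`,
  -- so the inequality can be pulled back to `B`.
  have key : ∀ u : A, IsSelfAdjoint u → ‖u‖ ≤ δ → ι 1 * u * ι 1 = u → u ≤ δ • ι 1 := by
    intro u hu hun hpu
    have := star_left_conjugate_le_conjugate (le_smul_one_of_norm_le hu hun) (ι 1)
    rwa [hsp, hpu, mul_smul_comm, smul_mul_assoc, mul_one, hpp] at this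
  refine ⟨y, hys, h3, key _ hus h3 hpup, ?_⟩
  rw [← neg_sub X]
  refine key _ hus.neg (by rwa [norm_neg]) ?_
  rw [mul_neg, neg_mul, hpup]

theorem norm_map_le_of_isContractive_single {n : ℕ} {F : Fin (n + 1) → Type u}
    [∀ i, CStarAlgebra (F i)] [∀ i, PartialOrder (F i)] [∀ i, StarOrderedRing (F i)]
    (φ : (∀ i, F i) →CP A) (h : ∀ i, IsContractive fun y : F i => φ (Pi.single i y))
    (z : ∀ i, F i) : ‖φ z‖ ≤ (n + 1) * ‖z‖ := by
  conv_lhs => rw [← Finset.univ_sum_single z, map_sum]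
  refine (norm_sum_le _ _).trans ?_
  calc ∑ i, ‖φ (Pi.single i (z i))‖ ≤ ∑ _i : Fin (n + 1), ‖z‖ :=
        Finset.sum_le_sum fun i _ => (h i _).trans (norm_le_pi_norm z i)
    _ = (n + 1) * ‖z‖ := by simp

end Main

/-! ### Estimates for the two conditions. -/

section Permanence

/-- If `r` almost commutes with a contraction `h`, then `r * r - h * (r * r) * h` is almost
`r * (1 - h * h) * r`. -/
theorem norm_conj_sq_sub_le {A : Type u} [CStarAlgebra A] {h r : A} (hn : ‖h‖ ≤ 1)
    {δ : ℝ} (hr : ‖h * r - r * h‖ ≤ δ) :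
    ‖r * (h * h) * r - h * (r * r) * h‖ ≤ 2 * δ * ‖r‖ := by
  have e : r * (h * h) * r - h * (r * r) * h
      = r * h * (h * r - r * h) - (h * r - r * h) * (r * h) := by noncomm_ring
  have hrh : ‖r * h‖ ≤ ‖r‖ := (norm_mul_le _ _).trans (mul_le_of_le_one_right (norm_nonneg _) hn)
  rw [e]
  refine (norm_sub_le _ _).trans ?_
  have h1 : ‖r * h * (h * r - r * h)‖ ≤ ‖r‖ * δ := (norm_mul_le _ _).trans (by gcongr)
  have h2 : ‖(h * r - r * h) * (r * h)‖ ≤ δ * ‖r‖ := (norm_mul_le _ _).trans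
    (mul_le_mul hr hrh (norm_nonneg _) ((norm_nonneg _).trans hr))
  linarith

variable {A B : Type u} [CStarAlgebra A] [PartialOrder A] [StarOrderedRing A]
  [CStarAlgebra B] [PartialOrder B] [StarOrderedRing B]

/-- The order estimate behind the second condition of tracial nuclear dimension: `Φ` is
`φ ∘ ψ` for the subalgebra, and `w` approximates `Φ q`. -/
theorem sub_le_cutDown_add (Φ : B →ₗ[ℂ] B) (hΦ : ∀ x, 0 ≤ x → 0 ≤ Φ x) {q w s : B} (hq : 0 ≤ q)
    (hq1 : q ≤ 1) (hs : 0 ≤ s) (hw : IsSelfAdjoint w) {η κ : ℝ}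
    (h1 : ‖1 - q - s - Φ (1 - q)‖ ≤ η) (h2 : ‖w - Φ q‖ ≤ κ) :
    q - w ≤ cutDown (1 - Φ 1) η + (2 * η + κ) • 1 := by
  have sa : ∀ x, 0 ≤ x → IsSelfAdjoint (Φ x) := fun x hx => .of_nonneg (hΦ x hx)
  have hq' : 0 ≤ 1 - q := sub_nonneg.2 hq1
  have e1 : -(1 - q - s - Φ (1 - q)) ≤ η • (1 : B) :=
    le_smul_one_of_norm_le (((IsSelfAdjoint.of_nonneg hq').sub (.of_nonneg hs)).sub (sa _ hq')).neg
      (by rwa [norm_neg])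
  have e2 : Φ q - w ≤ κ • (1 : B) :=
    le_smul_one_of_norm_le ((sa _ hq).sub hw) (by rwa [norm_sub_rev])
  have e3 : (1 - Φ 1) - η • 1 ≤ cutDown (1 - Φ 1) η := by
    have hsa : IsSelfAdjoint (1 - Φ 1) := (IsSelfAdjoint.one B).sub (sa 1 zero_le_one)
    rw [cutDown_eq_posPart hsa, Algebra.algebraMap_eq_smul_one]
    exact CFC.le_posPart (hsa.sub (.smul (.all η) (.one B)))
  have e4 : Φ (1 - q) = Φ 1 - Φ q := map_sub _ _ _
  have := add_le_add (add_le_add (add_le_add e1 e2) e3) (neg_nonpos.2 hs)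
  rw [← sub_nonneg] at this ⊢
  convert this using 1
  rw [e4]
  module

/-- From `(1 - h)² ≥ 0` one gets `1 - h² ≤ 2(1 - h)`. -/
theorem one_sub_sq_cuntzSubeq {h : A} (hsa : IsSelfAdjoint h) (h1 : h * h ≤ 1) :
    CuntzSubeq (1 - h * h) (1 - h) := by
  refine (CuntzSubeq.of_le (sub_nonneg.2 h1) ?_).trans (CuntzSubeq.smul_self zero_le_two (1 - h))
  have := star_mul_self_nonneg (1 - h)
  rw [((IsSelfAdjoint.one A).sub hsa).star_eq] at this
  rw [← sub_nonneg]
  convert this using 1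
  rw [two_smul]; noncomm_ring

end Permanence

end TracialApprox

/-! ### The permanence theorem. -/

open TracialApprox in
theorem theorem3p4 (n : ℕ) (Ω : ∀ (B : Type u) [CStarAlgebra B], Prop)
    (hΩ : ∀ (B : Type u) [CStarAlgebra B] [PartialOrder B] [StarOrderedRing B], Ω B →
      TracialApprox.IsNuclear B ∧ TracialApprox.HasTracialNucDimLE n B)
    (A : Type u) [CStarAlgebra A] [PartialOrder A] [StarOrderedRing A]
    (hsimple : TracialApprox.IsSimpleCStar A) (hA : TracialApprox.InWTA Ω A) :
    TracialApprox.HasTracialNucDimLE n A := by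
  classical
  by_cases hfin : FiniteDimensional ℂ A
  · exact hasTracialNucDimLE_of_finiteDimensional n A
  intro S hS ε hε a ha ha0
  obtain ⟨e, f, he, hf, he0, hf0, hef, hefa⟩ := hsimple.exists_orthogonal hfin ha ha0
  obtain ⟨d, hd, hd0, hde, hdf⟩ := hsimple.exists_common_subeq he hf he0 hf0
  -- The second condition costs `2η + (n + 1)η = ε`, where `n + 1` bounds the norm of `φ`, a sum of
  -- `n + 1` contractions.
  set η : ℝ := ε / (n + 3) with hη
  have hη0 : 0 < η := by positivity
  set R : ℝ := ∑ x ∈ S, ‖CFC.sqrt x‖ with hR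
  have hR0 : 0 ≤ R := Finset.sum_nonneg fun _ _ => norm_nonneg _
  -- The first bound makes the `δ`-errors `2δR + 2δ + 2(n + 1)δ` of the first condition at most `η`.
  -- The second makes `‖d‖ - δ > 2δ`, which keeps the cut-down of `h d h` in `B` nonzero.
  set δ : ℝ := min (η / (2 * R + 2 * n + 4)) (‖d‖ / 4) with hδ
  have hd' : 0 < ‖d‖ := norm_pos_iff.2 hd0
  have hδ0 : 0 < δ := lt_min (by positivity) (by positivity)
  have hδη : δ * (2 * R + 2 * n + 4) ≤ η := by
    rw [← le_div_iff₀ (by positivity)]; exact min_le_left _ _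
  have hδd : δ ≤ ‖d‖ / 4 := min_le_right _ _
  obtain ⟨p, g, B, instB, ι, hp, hg0, hg1, hΩB, hι, hιp, ⟨g', hg'⟩, happ, hcomm, hcu, hnorm⟩ :=
    hA δ hδ0 (S ∪ S.image CFC.sqrt ∪ {d}) d hd hd0
  let _ : PartialOrder B := CStarAlgebra.spectralOrder B
  have _ : StarOrderedRing B := CStarAlgebra.spectralOrderedRing B
  -- the positive contraction `h = p - g` in `B`
  set h' : B := 1 - g' with hh'
  have hιh : ι h' = p - g := by rw [hh', map_sub, hιp, hg']
  have hp1 : p ≤ 1 := hp.le_one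
  have hg'0 : 0 ≤ g' := by
    have hsa : IsSelfAdjoint g' := hι (by rw [map_star, hg', (IsSelfAdjoint.of_nonneg hg0).star_eq])
    rwa [← map_nonneg_iff_of_injective hι hsa, hg']
  have hh'sa : IsSelfAdjoint h' := (IsSelfAdjoint.one B).sub (.of_nonneg hg'0)
  have hh'0 : 0 ≤ h' := by
    rw [← map_nonneg_iff_of_injective hι hh'sa, hιh, sub_nonneg]
    have h1 := star_left_conjugate_le_conjugate hg1 p
    rw [hp.isSelfAdjoint.star_eq, mul_one, hp.isIdempotentElem.eq] at h1
    have h2 : p * g * p = g := by rw [← hg', ← hιp, ← map_mul, ← map_mul, one_mul, mul_one]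
    rwa [h2] at h1
  have hh'1 : h' ≤ 1 := by rw [hh']; exact sub_le_self _ hg'0
  have hh'n : ‖h'‖ ≤ 1 := (CStarAlgebra.norm_le_one_iff_of_nonneg h').2 hh'1
  rw [← hιh] at happ hcomm hcu hnorm
  set h : A := ι h' with hh
  have hsa : IsSelfAdjoint h := hh'sa.map ι
  have hn : ‖h‖ ≤ 1 := (isContractive_nonUnitalStarAlgHom ι h').trans hh'n
  have sq_le : ∀ {D : Type u} [CStarAlgebra D] [PartialOrder D] [StarOrderedRing D] (x : D),
      IsSelfAdjoint x → ‖x‖ ≤ 1 → 0 ≤ x * x ∧ x * x ≤ 1 := fun x hx hxn => by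
    have h1 := star_mul_self_nonneg x
    rw [hx.star_eq] at h1
    refine ⟨h1, (CStarAlgebra.norm_le_one_iff_of_nonneg _ h1).1 ?_⟩
    exact (norm_mul_le _ _).trans (mul_le_one₀ hxn (norm_nonneg _) hxn)
  obtain ⟨hq0, hq1⟩ := sq_le h' hh'sa hh'n
  obtain ⟨-, hhh1⟩ := sq_le h hsa hn
  -- a nonzero positive element of `B` below `f * f`
  obtain ⟨⟨yd, hyd⟩, -⟩ := happ d (by simp)
  obtain ⟨b', hb'sa, -, hb'1, hb'2⟩ :=
    exists_corner_approx ι hh'sa hh'n (IsSelfAdjoint.of_nonneg hd) hyd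
  have hbsa : IsSelfAdjoint (b' - δ • 1) := hb'sa.sub (.smul (.all δ) (.one B))
  have hιr : ∀ (r : ℝ) (x : B), ι (r • x) = r • ι x := fun r x => by
    rw [← Complex.coe_smul, map_smul, Complex.coe_smul]
  have hιb : CuntzSubeq (ι (b' - δ • 1)⁺) (f * f) := by
    rw [map_posPart_of_isSelfAdjoint ι hbsa]
    refine ((CuntzSubeq.posPart (hbsa.map ι) (d := h * d * h) ?_).trans ?_).trans hdf
    · rw [map_sub, hιr]; exact sub_le_comm.1 hb'2
    · have := CuntzSubeq.conj d h
      rwa [hsa.star_eq] at this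
  have hb0 : (b' - δ • 1)⁺ ≠ 0 := by
    intro h0
    rw [CFC.posPart_eq_zero_iff _ hbsa, sub_nonpos] at h0
    have h1 : ι b' ≤ δ • ι 1 := by
      have := OrderHomClass.mono ι h0
      rwa [hιr] at this
    have h2 : h * d * h ≤ algebraMap ℝ A (2 * δ) := by
      rw [Algebra.algebraMap_eq_smul_one, two_mul, add_smul]
      have h3 : δ • ι 1 ≤ δ • (1 : A) := smul_le_smul_of_nonneg_left (hιp ▸ hp1) hδ0.le
      calc h * d * h ≤ δ • ι 1 + ι b' := sub_le_iff_le_add.1 hb'1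
        _ ≤ _ := add_le_add h3 (h1.trans h3)
    have h4 := (CStarAlgebra.norm_le_iff_le_algebraMap _ (by positivity)
      (hsa.conjugate_nonneg hd)).2 h2
    linarith
  -- approximate the elements of `S` in `B`
  have hy : ∀ x : A, ∃ y : B, x ∈ S → 0 ≤ y ∧ ‖h * x * h - ι y‖ ≤ 2 * δ := by
    intro x
    by_cases hx : x ∈ S
    swap
    · exact ⟨0, fun h => absurd h hx⟩
    obtain ⟨⟨y₀, hy₀⟩, -⟩ := happ x (by simp [hx])
    obtain ⟨y₁, hy₁sa, hy₁n, hy₁, -⟩ :=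
      exists_corner_approx ι hh'sa hh'n (IsSelfAdjoint.of_nonneg (hS x hx)) hy₀
    -- Adding `δ` makes the approximant dominate `h x h ≥ 0`, at the price of a second `δ` in norm.
    refine ⟨y₁ + δ • 1, fun _ => ⟨?_, ?_⟩⟩
    · rw [← map_nonneg_iff_of_injective hι (hy₁sa.add (.smul (.all δ) (.one B))), map_add, hιr]
      have := sub_le_iff_le_add.1 hy₁
      rw [add_comm] at this
      exact (hsa.conjugate_nonneg (hS x hx)).trans this
    · have h1 : ‖δ • ι 1‖ ≤ δ := by
        rw [norm_smul, Real.norm_of_nonneg hδ0.le]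
        refine mul_le_of_le_one_right hδ0.le ?_
        rw [hιp]
        exact (CStarAlgebra.norm_le_one_iff_of_nonneg p hp.nonneg).2 hp1
      rw [map_add, hιr, ← sub_sub]
      exact (norm_sub_le _ _).trans (by linarith)
  choose y hy using hy
  obtain ⟨hnuc, hdim⟩ := hΩ B hΩB
  obtain ⟨k, α, β, hα, hβ, hβα⟩ := hnuc (S.image y ∪ {h' * h'}) η hη0
  -- The set contains `1 - h'²` rather than `h'²`: the positive remainder bounds `Φ(1 - h'²)` from
  -- above, hence `Φ(h'²)` from below, as the second condition needs.
  obtain ⟨F, _, _, _, _, ψ, φ, hφψ, hcut, hψ, hφ⟩ := hdim (S.image y ∪ {1 - h' * h'})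
    (by
      intro z hz
      rcases Finset.mem_union.1 hz with hz | hz
      · obtain ⟨x, hx, rfl⟩ := Finset.mem_image.1 hz
        exact (hy x hx).1
      · rw [Finset.mem_singleton.1 hz]; exact sub_nonneg.2 hq1)
    η hη0 _ (CFC.posPart_nonneg (b' - δ • 1)) hb0
  obtain ⟨α', hα', hαι⟩ := exists_cp_extension hι α hα
  have hφn := norm_map_le_of_isContractive_single φ fun i => (hφ i).1
  have hΦn : ∀ z, ‖φ (ψ z)‖ ≤ (n + 1) * ‖z‖ := fun z =>
    (hφn _).trans (by gcongr; exact hψ z)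
  have hΦβα : ∀ z, ‖β (α z) - z‖ < η → ‖φ (ψ (β (α z))) - φ (ψ z)‖ ≤ (n + 1) * η := fun z hz => by
    rw [← map_sub, ← map_sub]
    exact (hΦn _).trans (by gcongr)
  let ψA : A →CP (∀ i, F i) := cpComp ψ (cpComp β (cpComp α' (cpConj h hsa)))
  let φA : (∀ i, F i) →CP A := cpComp (cpOfStarAlgHom ι) φ
  have hφψA : ∀ x, φA (ψA x) = ι (φ (ψ (β (α' (h * x * h))))) := fun x => by
    rw [← cpConj_apply hsa x]; rfl
  refine ⟨F, inferInstance, inferInstance, inferInstance, inferInstance, ψA, φA, fun x hx => ?_,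
    ?_, ?_, fun i => ⟨fun z => ?_, fun z w hzw => ?_⟩⟩
  · obtain ⟨hyx0, hyx⟩ := hy x hx
    have hymem : y x ∈ S.image y := Finset.mem_image_of_mem y hx
    obtain ⟨y', hy'0, hy'⟩ := hφψ (y x) (Finset.mem_union_left _ hymem)
    set r := CFC.sqrt x with hr
    have hr0 : 0 ≤ r := CFC.sqrt_nonneg x
    have hrr : r * r = x := CFC.sqrt_mul_sqrt_self x (hS x hx)
    have hrR : ‖r‖ ≤ R :=
      Finset.single_le_sum (f := fun x => ‖CFC.sqrt x‖) (fun _ _ => norm_nonneg _) hx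
    refine ⟨r * (1 - h * h) * r + ι y',
      add_nonneg (conjugate_nonneg_of_nonneg (sub_nonneg.2 hhh1) hr0) (map_nonneg ι hy'0), ?_⟩
    have t1 : ‖r * (h * h) * r - h * x * h‖ ≤ 2 * δ * R := by
      have := norm_conj_sq_sub_le hn (hcomm r (Finset.mem_union_left _
        (Finset.mem_union_right _ (Finset.mem_image_of_mem _ hx)))).le
      rw [hrr] at this
      exact this.trans (by gcongr)
    have t3 : ‖ι (y x - y' - φ (ψ (y x)))‖ < η :=
      (isContractive_nonUnitalStarAlgHom ι _).trans_lt hy'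
    have t4 : ‖ι (φ (ψ (β (α (y x)))) - φ (ψ (y x)))‖ ≤ (n + 1) * η :=
      (isContractive_nonUnitalStarAlgHom ι _).trans
        (hΦβα _ (hβα _ (Finset.mem_union_left _ hymem)))
    have t5 : ‖φA (ψA x) - ι (φ (ψ (β (α (y x)))))‖ ≤ (n + 1) * (2 * δ) := by
      rw [hφψA, ← hαι, ← map_sub, ← map_sub, ← map_sub, ← map_sub, ← map_sub]
      refine (isContractive_nonUnitalStarAlgHom ι _).trans ((hΦn _).trans ?_)
      gcongr
      exact ((hβ _).trans (hα' _)).trans hyx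
    -- The five errors are commutation of `r` with `h`, approximation in `B`, the dimension of `B`,
    -- nuclearity, and replacing `h x h` by `ι (y x)` inside the maps.
    have e1 : x - (r * (1 - h * h) * r + ι y') - φA (ψA x)
        = (r * (h * h) * r - h * x * h) + (h * x * h - ι (y x))
          + ι (y x - y' - φ (ψ (y x))) - ι (φ (ψ (β (α (y x)))) - φ (ψ (y x)))
          - (φA (ψA x) - ι (φ (ψ (β (α (y x)))))) := by
      have : r * (1 - h * h) * r = x - r * (h * h) * r := by
        rw [mul_sub, sub_mul, mul_one, hrr]
      rw [this]
      simp only [map_sub]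
      abel
    rw [e1]
    have n1 := norm_sub_le ((r * (h * h) * r - h * x * h) + (h * x * h - ι (y x))
          + ι (y x - y' - φ (ψ (y x))) - ι (φ (ψ (β (α (y x)))) - φ (ψ (y x))))
          (φA (ψA x) - ι (φ (ψ (β (α (y x))))))
    have n2 := norm_sub_le ((r * (h * h) * r - h * x * h) + (h * x * h - ι (y x))
          + ι (y x - y' - φ (ψ (y x)))) (ι (φ (ψ (β (α (y x)))) - φ (ψ (y x))))
    have n3 := norm_add₃_le (a := r * (h * h) * r - h * x * h) (b := h * x * h - ι (y x))
      (c := ι (y x - y' - φ (ψ (y x))))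
    have hεη : (n + 3) * η = ε := by rw [hη]; field_simp
    linarith
  · obtain ⟨s, hs0, hs⟩ := hφψ (1 - h' * h') (by simp)
    let Φ : B →ₗ[ℂ] B := φ.toLinearMap ∘ₗ ψ.toLinearMap
    have hΦ0 : ∀ x, 0 ≤ x → 0 ≤ Φ x := fun x hx => map_nonneg φ (map_nonneg ψ hx)
    have hw : IsSelfAdjoint (φ (ψ (β (α (h' * h'))))) := .of_nonneg <|
      map_nonneg φ (map_nonneg ψ (map_nonneg β (map_nonneg α hq0)))
    have h1 := sub_le_cutDown_add Φ hΦ0 hq0 hq1 hs0 hw hs.le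
      (hΦβα _ (hβα _ (by simp)))
    set c := cutDown (1 - Φ 1) η with hc
    have hw' : φA (ψA 1) = ι (φ (ψ (β (α (h' * h'))))) := by
      rw [hφψA, mul_one, hh, ← map_mul, hαι]
    have hX : IsSelfAdjoint (1 - φA (ψA 1)) := by
      rw [hw']; exact (IsSelfAdjoint.one A).sub (hw.map ι)
    rw [cutDown_eq_posPart hX]
    -- The scalar error is a multiple of `p ≤ 1` with coefficient exactly `ε`, so the cut by `ε`
    -- absorbs it.
    refine (CuntzSubeq.posPart (d := (1 - h * h) + ι c)
      (hX.sub (.algebraMap A (.all ε))) ?_).trans ?_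
    · have h2 := OrderHomClass.mono ι h1
      rw [map_sub, map_mul, map_add, hιr, ← hw', ← hh] at h2
      have h3 : (2 * η + (n + 1) * η) • ι 1 ≤ algebraMap ℝ A ε := by
        have : 2 * η + (n + 1) * η = ε := by rw [hη]; field_simp; ring
        rw [this, Algebra.algebraMap_eq_smul_one]
        exact smul_le_smul_of_nonneg_left (hιp ▸ hp1) hε.le
      have h4 := add_le_add h2 h3
      rw [← sub_nonneg] at h4 ⊢
      convert h4 using 1
      abel
    · have hsq : ∀ x : A, 0 ≤ x → 0 ≤ x * x := fun x hx => by
        simpa [(IsSelfAdjoint.of_nonneg hx).star_eq] using star_mul_self_nonneg x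
      refine (CuntzSubeq.add ((one_sub_sq_cuntzSubeq hsa hhh1).trans (hcu.trans hde))
        ((hcut.map ι).trans hιb)
        (hsq e he) (hsq f hf) ?_).trans hefa
      rw [mul_assoc, ← mul_assoc e f f, hef, zero_mul, mul_zero]
  · intro x
    refine (hψ _).trans ((hβ _).trans ((hα' _).trans ?_))
    change ‖cpConj h hsa x‖ ≤ ‖x‖
    rw [cpConj_apply]
    calc ‖h * x * h‖ ≤ ‖h‖ * ‖x‖ * ‖h‖ := norm_mul₃_le
      _ ≤ 1 * ‖x‖ * 1 := by gcongr
      _ = ‖x‖ := by ring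
  · exact (isContractive_nonUnitalStarAlgHom ι _).trans ((hφ i).1 z)
  · change ι (φ (Pi.single i z)) * ι (φ (Pi.single i w)) = 0
    rw [← map_mul, (hφ i).2 z w hzw, map_zero]
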